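/- Let $\mathcal{A}$ be an infinite set of attributes, each attribute $A\in\mathcal{A}$ having an infinite domain $\mathrm{Dom}(A)$. A relation schema $R$ is a finite subset of $\mathcal{A}$, a tuple over $R$ is a map $t$ on $R$ with $t(A)\in\mathrm{Dom}(A)$ for each $A\in R$, and a relation over $R$ is a set of tuples over $R$; $t(X)$ denotes the restriction of $t$ to $X\subseteq R$. For arbitrary $X,Y\subseteq R$ (independence atoms thus have arbitrary arity), a relation $r$ over $R$ satisfies the key $k(X)$ if for all $t,t'\in r$, $t(X)=t'(X)$ implies $t=t'$; it satisfies the independence atom $X\perp Y$ if for all $t,t'\in r$ there is $t''\in r$ with $t''(X)=t(X)$ and $t''(Y)=t'(Y)$. For a set $\Sigma\cup\{\varphi\}$ of keys and independence atoms over $R$, write $\Sigma\models_{\mathrm{FIN}}\varphi$ if every finite relation over $R$ satisfying all elements of $\Sigma$ satisfies $\varphi$. An inference rule with $l$ premises specifies, for each relation schema $R$, a set of instances $\frac{\sigma_1\;\cdots\;\sigma_l}{\sigma}$, where $\sigma_1,\dots,\sigma_l,\sigma$ are keys or independence atoms over $R$. For a set $\mathfrak{R}$ of inference rules, $\Sigma\vdash_{\mathfrak{R}}\varphi$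 means that $\varphi$ is obtained from elements of $\Sigma$ by finitely many applications of rules in $\mathfrak{R}$. The set $\mathfrak{R}$ is $k$-ary if each of its rules has at most $k$ premises; it is sound (respectively complete) for the finite implication problem for independence atoms and keys if, for every relation schema $R$ and every set $\Sigma\cup\{\varphi\}$ of keys and independence atoms over $R$, $\Sigma\vdash_{\mathfrak{R}}\varphi$ implies $\Sigma\models_{\mathrm{FIN}}\varphi$ (respectively $\Sigma\models_{\mathrm{FIN}}\varphi$ implies $\Sigma\vdash_{\mathfrak{R}}\varphi$). Then for no natural number $k$ does there exist a $k$-ary set of inference rules, finite or infinite, that is sound and complete for the finite implication problem for independence atoms and keys taken together. -/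

import Mathlib

namespace KeyIndep

universe u v

/-- Keys `k(X)` and independence atoms `X ⊥ Y` (of arbitrary arity) over a relation schema `R`,
where `R` is a finite set of attributes and `X, Y ⊆ R` are arbitrary (possibly empty or overlapping)
sets of attributes of `R`. -/
inductive Constraint {Attr : Type u} (R : Finset Attr) : Type u
  | key (X : Set {A // A ∈ R}) : Constraint R
  | indep (X Y : Set {A // A ∈ R}) : Constraint R

/-- A tuple over `R` assigns to every attribute `A` of `R` a value in the domain of `A`. -/
abbrev Tuple {Attr : Type u} (Dom : Attr → Type v) (R : Finset Attr) : Type (max u v) :=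
  (A : {A // A ∈ R}) → Dom A.1

/-- `t(X) = t'(X)`: the restrictions of `t` and `t'` to `X` coincide. -/
def AgreeOn {Attr : Type u} {Dom : Attr → Type v} {R : Finset Attr}
    (X : Set {A // A ∈ R}) (t t' : Tuple Dom R) : Prop :=
  ∀ A ∈ X, t A = t' A

/-- `r ⊨ φ` for a relation `r` over `R`, that is, for a set `r` of tuples over `R`. -/
def Satisfies {Attr : Type u} {Dom : Attr → Type v} {R : Finset Attr}
    (r : Set (Tuple Dom R)) : Constraint R → Prop
  | .key X => ∀ t ∈ r, ∀ t' ∈ r, AgreeOn X t t' → t = t'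
  | .indep X Y => ∀ t ∈ r, ∀ t' ∈ r, ∃ t'' ∈ r, AgreeOn X t'' t ∧ AgreeOn Y t'' t'

/-- Finite implication `S ⊨_FIN φ`: every finite relation over `R` that satisfies all elements
of `S` satisfies `φ`. -/
def FinImplies {Attr : Type u} (Dom : Attr → Type v) {R : Finset Attr}
    (S : Set (Constraint R)) (φ : Constraint R) : Prop :=
  ∀ r : Set (Tuple Dom R), r.Finite → (∀ ψ ∈ S, Satisfies r ψ) → Satisfies r φ

/-- An inference rule with `arity` many premises, given by its set of instances
(premises, conclusion) over each relation schema. No restriction is made on how the instances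
are specified. -/
structure InferenceRule (Attr : Type u) : Type u where
  arity : ℕ
  instances : (R : Finset Attr) → Set ((Fin arity → Constraint R) × Constraint R)

/-- `S ⊢ φ`: `φ` is obtained from the elements of `S` by finitely many applications of the
inference rules in `I`. -/
inductive Derives {Attr : Type u} (I : Set (InferenceRule Attr)) {R : Finset Attr}
    (S : Set (Constraint R)) : Constraint R → Prop
  | hyp {φ : Constraint R} (h : φ ∈ S) : Derives I S φ
  | step {ρ : InferenceRule Attr} (hρ : ρ ∈ I) {P : Fin ρ.arity → Constraint R}
      {φ : Constraint R} (hinst : (P, φ) ∈ ρ.instances R) (hP : ∀ i, Derives I S (P i)) :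
      Derives I S φ

/-- `I` is sound for the finite implication problem of keys and independence atoms. -/
def FinSound {Attr : Type u} (Dom : Attr → Type v) (I : Set (InferenceRule Attr)) : Prop :=
  ∀ (R : Finset Attr) (S : Set (Constraint R)) (φ : Constraint R),
    Derives I S φ → FinImplies Dom S φ

/-- `I` is complete for the finite implication problem of keys and independence atoms. -/
def FinComplete {Attr : Type u} (Dom : Attr → Type v) (I : Set (InferenceRule Attr)) : Prop :=
  ∀ (R : Finset Attr) (S : Set (Constraint R)) (φ : Constraint R),
    FinImplies Dom S φ → Derives I S φ

/-- `I` is `k`-ary: every rule in `I` has at most `k` premises. -/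
def IsAry {Attr : Type u} (k : ℕ) (I : Set (InferenceRule Attr)) : Prop :=
  ∀ ρ ∈ I, ρ.arity ≤ k

end KeyIndep

/-! Take attributes `A l`, `B l` for `l` in `ZMod n`, `n = k + 2`, with atoms `A l ⊥ B l` and keys
`k(B l, A (l + 1))`. In a finite nonempty relation `r`, |A l|·|B l| ≤ |r| ≤ |B l|·|A (l + 1)| for
the numbers of values, so |A l| never drops around the cycle. Hence all these bounds are equalities
and every `{A l, B l}` is a key (`key_of_cycle`).

Omitting the key with index `i` opens the cycle. A constraint in the union of the sets
`cycleConstraints e i` is missing from at most one of them, so `k < n` premises from the union lie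
in a common one. Any conclusion outside the union is refuted by a finite model of that one
(`separable_of_forall_notMem`). The union is thus closed under sound `k`-ary rules, yet finitely
implies a key it does not contain.

The models consist of polynomials of degree less than `d` over a finite field, each attribute
recording the values at some points. Values at `d` points determine the polynomial, and values at up
to `d` distinct points are arbitrary, so keys and independence reduce to counting points. -/

namespace KeyIndep

open Polynomial

universe u v

/-! ### Relations from polynomial evaluation -/

section PolynomialRelation

variable {Attr : Type u} {Dom : Attr → Type v} {R : Finset Attr} {F : Type} [Field F] [Finite F]

theorem nonempty_embedding_of_finite_of_infinite (α β : Type*) [Finite α] [Infinite β] :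
    Nonempty (α ↪ β) :=
  ⟨(Finite.equivFin α).toEmbedding.trans (Fin.valEmbedding.trans (Infinite.natEmbedding β))⟩

/-- The tuple that stores at the attribute `A` the values of the polynomial `p` at the points
`pts A`, encoded in the domain of `A`. -/
noncomputable def evalTuple (Dom : Attr → Type v) [∀ A, Infinite (Dom A)]
    (pts : {A // A ∈ R} → Finset F) (p : F[X]) : Tuple Dom R :=
  fun A => (nonempty_embedding_of_finite_of_infinite (pts A → F) (Dom A.1)).some
    fun x => p.eval x.1

/-- The evaluation tuples of all polynomials of degree less than `d`. -/
def evalRelation (Dom : Attr → Type v) [∀ A, Infinite (Dom A)] (d : ℕ)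
    (pts : {A // A ∈ R} → Finset F) : Set (Tuple Dom R) :=
  evalTuple Dom pts '' {p | p.degree < d}

variable [∀ A, Infinite (Dom A)] {d : ℕ} {pts : {A // A ∈ R} → Finset F}

theorem evalTuple_apply_eq_iff {p q : F[X]} {A : {A // A ∈ R}} :
    evalTuple Dom pts p A = evalTuple Dom pts q A ↔ ∀ x ∈ pts A, p.eval x = q.eval x := by
  simp only [evalTuple, EmbeddingLike.apply_eq_iff_eq, funext_iff, Subtype.forall]

theorem evalRelation_finite : (evalRelation Dom d pts).Finite := by
  refine Set.Finite.image _ ?_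
  have : Finite (degreeLT F d) := Finite.of_equiv _ (degreeLTEquiv F d).symm.toEquiv
  refine (Set.toFinite (degreeLT F d : Set F[X])).subset fun p hp => ?_
  exact mem_degreeLT.2 hp

theorem evalRelation_satisfies_key {X : Set {A // A ∈ R}} (s : Finset F) (hd : d ≤ s.card)
    (hs : ∀ x ∈ s, ∃ A ∈ X, x ∈ pts A) : Satisfies (evalRelation Dom d pts) (.key X) := by
  rintro _ ⟨p, hp, rfl⟩ _ ⟨q, hq, rfl⟩ h
  have hd' : (d : WithBot ℕ) ≤ s.card := by exact_mod_cast hd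
  have : p = q := by
    refine eq_of_degrees_lt_of_eval_finset_eq s (lt_of_lt_of_le hp hd') (lt_of_lt_of_le hq hd')
      fun x hx => ?_
    obtain ⟨A, hA, hxA⟩ := hs x hx
    exact evalTuple_apply_eq_iff.1 (h A hA) x hxA
  rw [this]

/-- The nodal polynomial of `s` agrees with `0` on `X` but not at `y`. -/
theorem evalRelation_not_satisfies_key {X : Set {A // A ∈ R}} (s : Finset F) (hd : s.card < d)
    (hs : ∀ A ∈ X, pts A ⊆ s) {B : {A // A ∈ R}} {y : F} (hy : y ∈ pts B) (hys : y ∉ s) :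
    ¬ Satisfies (evalRelation Dom d pts) (.key X) := by
  intro h
  have hdeg : (Lagrange.nodal s id : F[X]).degree < d := by
    rw [Lagrange.degree_nodal]; exact_mod_cast hd
  have := h _ ⟨_, hdeg, rfl⟩ _ ⟨0, by simp [bot_lt_iff_ne_bot], rfl⟩ fun A hA =>
    evalTuple_apply_eq_iff.2 fun x hx => by
      simpa using Lagrange.eval_nodal_at_node (v := (id : F → F)) (hs A hA hx)
  have h0 := evalTuple_apply_eq_iff.1 (congrFun this B) y hy
  refine Lagrange.eval_nodal_not_at_node (v := (id : F → F)) (s := s) (x := y) ?_ (by simpa using h0)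
  rintro x hx rfl
  exact hys hx

theorem evalRelation_satisfies_indep {A B : {A // A ∈ R}} (hAB : Disjoint (pts A) (pts B))
    (hd : (pts A).card + (pts B).card ≤ d) :
    Satisfies (evalRelation Dom d pts) (.indep {A} {B}) := by
  classical
  rintro _ ⟨p, hp, rfl⟩ _ ⟨q, hq, rfl⟩
  have hdeg := Lagrange.degree_interpolate_lt (s := pts A ∪ pts B) (v := (id : F → F))
    (fun x => if x ∈ pts A then p.eval x else q.eval x) Function.injective_id.injOn
  have hev := fun x (hx : x ∈ pts A ∪ pts B) => Lagrange.eval_interpolate_at_node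
    (s := pts A ∪ pts B) (v := (id : F → F))
    (fun x => if x ∈ pts A then p.eval x else q.eval x) Function.injective_id.injOn hx
  refine ⟨_, ⟨_, lt_of_lt_of_le hdeg ?_, rfl⟩, ?_, ?_⟩
  · rw [Finset.card_union_of_disjoint hAB]; exact_mod_cast hd
  · rintro _ rfl
    refine evalTuple_apply_eq_iff.2 fun x hx => ?_
    simpa [hx] using hev x (Finset.mem_union_left _ hx)
  · rintro _ rfl
    refine evalTuple_apply_eq_iff.2 fun x hx => ?_
    simpa [Finset.disjoint_right.1 hAB hx] using hev x (Finset.mem_union_right _ hx)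

theorem evalRelation_not_satisfies_indep_of_mem {X Y : Set {A // A ∈ R}} {A B : {A // A ∈ R}}
    (hA : A ∈ X) (hB : B ∈ Y) (hd : 0 < d) {x : F} (hxA : x ∈ pts A) (hxB : x ∈ pts B) :
    ¬ Satisfies (evalRelation Dom d pts) (.indep X Y) := by
  intro h
  obtain ⟨_, ⟨p, -, rfl⟩, h0, h1⟩ := h _ ⟨0, by simp [bot_lt_iff_ne_bot], rfl⟩
    _ ⟨1, by simpa using hd, rfl⟩
  have e0 := evalTuple_apply_eq_iff.1 (h0 A hA) x hxA
  have e1 := evalTuple_apply_eq_iff.1 (h1 B hB) x hxB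
  simp [e0] at e1

/-- Combine `0` on `A` with the Lagrange basis polynomial of a point `y` on `B`. The result would
vanish at |pts A| + |pts B| - 1 ≥ `d` points, hence everywhere, yet equal 1 at `y`. -/
theorem evalRelation_not_satisfies_indep_of_card {X Y : Set {A // A ∈ R}} {A B : {A // A ∈ R}}
    (hA : A ∈ X) (hB : B ∈ Y) (hAB : Disjoint (pts A) (pts B)) (hBd : (pts B).card ≤ d)
    (hne : (pts B).Nonempty) (hd : d < (pts A).card + (pts B).card) :
    ¬ Satisfies (evalRelation Dom d pts) (.indep X Y) := by
  classical
  intro h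
  obtain ⟨y, hy⟩ := hne
  have hdeg := Lagrange.degree_interpolate_lt (s := pts B) (v := (id : F → F))
    (Pi.single y 1) Function.injective_id.injOn
  have hev := fun x (hx : x ∈ pts B) => Lagrange.eval_interpolate_at_node
    (s := pts B) (v := (id : F → F)) (Pi.single y 1) Function.injective_id.injOn hx
  obtain ⟨_, ⟨p, hp, rfl⟩, h0, h1⟩ := h _ ⟨0, by simp [bot_lt_iff_ne_bot], rfl⟩
    _ ⟨_, lt_of_lt_of_le hdeg (by exact_mod_cast hBd), rfl⟩
  have e0 := evalTuple_apply_eq_iff.1 (h0 A hA)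
  have e1 := evalTuple_apply_eq_iff.1 (h1 B hB)
  have hp0 : p = 0 := by
    refine eq_zero_of_degree_lt_of_eval_finset_eq_zero (pts A ∪ (pts B).erase y)
      (lt_of_lt_of_le hp ?_) fun x hx => ?_
    · rw [Finset.card_union_of_disjoint (hAB.mono_right (Finset.erase_subset _ _)),
        Finset.card_erase_of_mem hy]
      have : 0 < (pts B).card := Finset.card_pos.2 ⟨y, hy⟩
      exact_mod_cast (by omega : d ≤ (pts A).card + ((pts B).card - 1))
    · rcases Finset.mem_union.1 hx with hx | hx
      · simpa using e0 x hx
      · have h2 := hev x (Finset.mem_of_mem_erase hx)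
        rw [e1 x (Finset.mem_of_mem_erase hx)]
        simpa [Finset.ne_of_mem_erase hx] using h2
  have h3 := e1 y hy
  have h4 := hev y hy
  rw [hp0] at h3
  simp only [id_eq, Pi.single_eq_same] at h4
  rw [h4] at h3
  simp at h3

end PolynomialRelation

/-! ### Counting values in finite relations -/

section Counting

variable {Attr : Type u} {Dom : Attr → Type v} {R : Finset Attr} {r : Set (Tuple Dom R)}

/-- The number of values that the attribute `A` takes in `r`. -/
noncomputable def numValues (r : Set (Tuple Dom R)) (A : {A // A ∈ R}) : ℕ :=
  ((fun t : Tuple Dom R => t A) '' r).ncard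

theorem ncard_image_pair_of_indep {A B : {A // A ∈ R}} (h : Satisfies r (.indep {A} {B})) :
    ((fun t : Tuple Dom R => (t A, t B)) '' r).ncard = numValues r A * numValues r B := by
  rw [numValues, numValues, ← Set.ncard_prod]
  congr 1
  ext ⟨a, b⟩
  constructor
  · rintro ⟨t, ht, e⟩
    simp only [Prod.mk.injEq] at e
    exact ⟨⟨t, ht, e.1⟩, ⟨t, ht, e.2⟩⟩
  · rintro ⟨⟨t, ht, e⟩, ⟨t', ht', e'⟩⟩
    obtain ⟨s, hs, h1, h2⟩ := h t ht t' ht'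
    exact ⟨s, hs, Prod.ext ((h1 A rfl).trans e) ((h2 B rfl).trans e')⟩

theorem numValues_mul_le_ncard_of_indep {A B : {A // A ∈ R}} (hr : r.Finite)
    (h : Satisfies r (.indep {A} {B})) : numValues r A * numValues r B ≤ r.ncard := by
  rw [← ncard_image_pair_of_indep h]
  exact Set.ncard_image_le hr

theorem ncard_le_numValues_mul_of_key {A B : {A // A ∈ R}} (hr : r.Finite)
    (h : Satisfies r (.key {A, B})) : r.ncard ≤ numValues r A * numValues r B := by
  rw [numValues, numValues, ← Set.ncard_prod]
  refine Set.ncard_le_ncard_of_injOn (fun t => (t A, t B))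
    (fun t ht => ⟨⟨t, ht, rfl⟩, ⟨t, ht, rfl⟩⟩) ?_ ((hr.image _).prod (hr.image _))
  intro t ht t' ht' e
  simp only [Prod.mk.injEq] at e
  refine h t ht t' ht' ?_
  rintro C (rfl | rfl)
  exacts [e.1, e.2]

theorem key_of_indep_of_ncard_le {A B : {A // A ∈ R}} (hr : r.Finite)
    (h : Satisfies r (.indep {A} {B})) (hle : r.ncard ≤ numValues r A * numValues r B) :
    Satisfies r (.key {A, B}) := by
  intro t ht t' ht' e
  refine Set.injOn_of_ncard_image_eq (f := fun t : Tuple Dom R => (t A, t B)) (s := r) ?_ hr ht ht'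
    (Prod.ext (e A (by simp)) (e B (by simp)))
  rw [ncard_image_pair_of_indep h]
  exact le_antisymm (numValues_mul_le_ncard_of_indep hr h) hle

/-- Around a cycle of attributes with `A l ⊥ B l` and `k(B l, A (l + 1))`, all the sets
`{A l, B l}` are keys of finite relations. -/
theorem key_of_cycle {n : ℕ} [NeZero n] (A B : ZMod n → {A // A ∈ R}) (hr : r.Finite)
    (hi : ∀ l, Satisfies r (.indep {A l} {B l}))
    (hk : ∀ l, Satisfies r (.key {B l, A (l + 1)})) (l : ZMod n) :
    Satisfies r (.key {A l, B l}) := by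
  rcases r.eq_empty_or_nonempty with rfl | ⟨t, ht⟩
  · exact fun _ h => h.elim
  have step : ∀ l, numValues r (A l) ≤ numValues r (A (l + 1)) := fun l => by
    have h := (numValues_mul_le_ncard_of_indep hr (hi l)).trans
      (ncard_le_numValues_mul_of_key hr (hk l))
    rw [mul_comm] at h
    exact Nat.le_of_mul_le_mul_left h ((Set.ncard_pos (hr.image _)).2 ⟨_, t, ht, rfl⟩)
  have steps : ∀ (m : ℕ) (l : ZMod n), numValues r (A l) ≤ numValues r (A (l + m)) := by
    intro m
    induction m with
    | zero => intro l; simp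
    | succ m ih =>
      intro l
      refine (ih l).trans ((step _).trans (le_of_eq ?_))
      push_cast
      rw [add_assoc]
  -- Going `n - 1` steps further from `l + 1` closes the cycle at `l`.
  have back : numValues r (A (l + 1)) ≤ numValues r (A l) := by
    refine (steps (n - 1) (l + 1)).trans (le_of_eq ?_)
    rw [add_assoc, ← Nat.cast_one, ← Nat.cast_add, Nat.add_sub_cancel' (NeZero.one_le),
      ZMod.natCast_self, add_zero]
  refine key_of_indep_of_ncard_le hr (hi l) ((ncard_le_numValues_mul_of_key hr (hk l)).trans ?_)
  rw [mul_comm]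
  exact Nat.mul_le_mul_right _ back

end Counting

/-! ### The cycle with one key omitted -/

section Cycle

variable {Attr : Type u} {Dom : Attr → Type v} {R : Finset Attr} {n : ℕ}

/-- The constraints that follow from the atoms `A l ⊥ B l`, the keys with three attributes, and
the keys `k(B l, A (l + 1))` for `l ≠ i`, where `A l` and `B l` are the attributes with the
coordinates `(l, false)` and `(l, true)`. -/
def cycleConstraints (e : {A // A ∈ R} ≃ ZMod n × Bool) (i : ZMod n) : Set (Constraint R)
  | .key X => (∃ x ∈ X, ∃ y ∈ X, ∃ z ∈ X, x ≠ y ∧ x ≠ z ∧ y ≠ z) ∨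
      ∃ l ≠ i, e.symm (l, true) ∈ X ∧ e.symm (l + 1, false) ∈ X
  | .indep X Y => X = ∅ ∨ Y = ∅ ∨
      ∃ l b, X = {e.symm (l, b)} ∧ Y = {e.symm (l, !b)}

/-- Only a two-attribute key depends on `i`, and one pair inside it suffices as a witness, so a
single index is excluded. -/
theorem exists_forall_ne_mem_cycleConstraints {e : {A // A ∈ R} ≃ ZMod n × Bool} {i : ZMod n}
    {φ : Constraint R} (h : φ ∈ cycleConstraints e i) :
    ∃ l, ∀ j ≠ l, φ ∈ cycleConstraints e j := by
  cases φ with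
  | key X =>
    rcases h with h | ⟨l, -, h⟩
    · exact ⟨i, fun j _ => Or.inl h⟩
    · exact ⟨l, fun j hj => Or.inr ⟨l, hj.symm, h⟩⟩
  | indep X Y => exact ⟨i, fun j _ => h⟩

theorem Satisfies.indep_symm {r : Set (Tuple Dom R)} {X Y : Set {A // A ∈ R}}
    (h : Satisfies r (.indep X Y)) : Satisfies r (.indep Y X) := fun t ht t' ht' => by
  obtain ⟨s, hs, h1, h2⟩ := h t' ht' t ht
  exact ⟨s, hs, h2, h1⟩

theorem satisfies_cycleConstraints {e : {A // A ∈ R} ≃ ZMod n × Bool} {i : ZMod n}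
    {r : Set (Tuple Dom R)}
    (h3 : ∀ X : Set {A // A ∈ R}, ∀ x ∈ X, ∀ y ∈ X, ∀ z ∈ X, x ≠ y → x ≠ z → y ≠ z →
      Satisfies r (.key X))
    (h2 : ∀ X : Set {A // A ∈ R}, ∀ l ≠ i, e.symm (l, true) ∈ X → e.symm (l + 1, false) ∈ X →
      Satisfies r (.key X))
    (hi : ∀ l, Satisfies r (.indep {e.symm (l, false)} {e.symm (l, true)})) :
    ∀ ψ ∈ cycleConstraints e i, Satisfies r ψ := by
  rintro (X | ⟨X, Y⟩) h
  · rcases h with ⟨x, hx, y, hy, z, hz, hxy, hxz, hyz⟩ | ⟨l, hl, h⟩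
    · exact h3 X x hx y hy z hz hxy hxz hyz
    · exact h2 X l hl h.1 h.2
  · rcases h with rfl | rfl | ⟨l, b, rfl, rfl⟩
    · exact fun t _ t' ht' => ⟨t', ht', fun _ h => h.elim, fun _ _ => rfl⟩
    · exact fun t ht t' _ => ⟨t, ht, fun _ _ => rfl, fun _ h => h.elim⟩
    · cases b
      · exact hi l
      · exact (hi l).indep_symm

variable {F : Type}

open Classical in
/-- Each attribute gets one private point, and a second one if it satisfies `two`. -/
noncomputable def privatePoints (e : {A // A ∈ R} ≃ ZMod n × Bool)
    (pt : (ZMod n × Bool) × Bool ↪ F) (two : ZMod n × Bool → Prop) (A : {A // A ∈ R}) : Finset F :=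
  if two (e A) then {pt (e A, false), pt (e A, true)} else {pt (e A, false)}

/-! ### Models with disjoint point sets, degree less than 3 -/

section PrivatePoints

variable {e : {A // A ∈ R} ≃ ZMod n × Bool} {pt : (ZMod n × Bool) × Bool ↪ F}
  {two : ZMod n × Bool → Prop}

theorem mem_privatePoints {A : {A // A ∈ R}} {x : F} :
    x ∈ privatePoints e pt two A ↔ x = pt (e A, false) ∨ two (e A) ∧ x = pt (e A, true) := by
  unfold privatePoints
  split_ifs with h <;> simp [h]

theorem card_privatePoints_of_two {A : {A // A ∈ R}} (h : two (e A)) :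
    (privatePoints e pt two A).card = 2 := by
  classical
  rw [privatePoints, if_pos h, Finset.card_pair]
  simp

theorem card_privatePoints_of_not_two {A : {A // A ∈ R}} (h : ¬ two (e A)) :
    (privatePoints e pt two A).card = 1 := by
  rw [privatePoints, if_neg h, Finset.card_singleton]

theorem one_le_card_privatePoints (A : {A // A ∈ R}) :
    1 ≤ (privatePoints e pt two A).card :=
  Finset.card_pos.2 ⟨_, mem_privatePoints.2 (Or.inl rfl)⟩

theorem disjoint_privatePoints {A B : {A // A ∈ R}} (h : A ≠ B) :
    Disjoint (privatePoints e pt two A) (privatePoints e pt two B) := by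
  rw [Finset.disjoint_left]
  intro x hA hB
  rw [mem_privatePoints] at hA hB
  rcases hA with rfl | ⟨-, rfl⟩ <;> rcases hB with h' | ⟨-, h'⟩ <;> simp at h' <;> exact h h'

variable [Field F] [Finite F] [∀ A, Infinite (Dom A)]

theorem privatePoints_satisfies_cycleConstraints {i : ZMod n}
    (hi : ∀ l, ¬ (two (l, false) ∧ two (l, true)))
    (hk : ∀ l ≠ i, two (l, true) ∨ two (l + 1, false)) :
    ∀ ψ ∈ cycleConstraints e i, Satisfies (evalRelation Dom 3 (privatePoints e pt two)) ψ := by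
  classical
  refine satisfies_cycleConstraints ?_ ?_ ?_
  · intro X x hx y hy z hz hxy hxz hyz
    refine evalRelation_satisfies_key {pt (e x, false), pt (e y, false), pt (e z, false)} ?_ ?_
    · rw [Finset.card_eq_three.2 ⟨_, _, _, ?_, ?_, ?_, rfl⟩] <;> simpa
    · intro w hw
      simp only [Finset.mem_insert, Finset.mem_singleton] at hw
      rcases hw with rfl | rfl | rfl
      exacts [⟨x, hx, mem_privatePoints.2 (.inl rfl)⟩, ⟨y, hy, mem_privatePoints.2 (.inl rfl)⟩,
        ⟨z, hz, mem_privatePoints.2 (.inl rfl)⟩]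
  · intro X l hl h1 h2
    refine evalRelation_satisfies_key (privatePoints e pt two (e.symm (l, true)) ∪
      privatePoints e pt two (e.symm (l + 1, false))) ?_ ?_
    · rw [Finset.card_union_of_disjoint (disjoint_privatePoints (by simp))]
      have a1 := one_le_card_privatePoints (e := e) (pt := pt) (two := two) (e.symm (l, true))
      have a2 := one_le_card_privatePoints (e := e) (pt := pt) (two := two) (e.symm (l + 1, false))
      rcases hk l hl with h | h
      · have := card_privatePoints_of_two (e := e) (pt := pt) (two := two)
          (A := e.symm (l, true)) (by simpa using h)
        omega
      · have := card_privatePoints_of_two (e := e) (pt := pt) (two := two)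
          (A := e.symm (l + 1, false)) (by simpa using h)
        omega
    · intro x hx
      rcases Finset.mem_union.1 hx with hx | hx
      exacts [⟨_, h1, hx⟩, ⟨_, h2, hx⟩]
  · intro l
    refine evalRelation_satisfies_indep (disjoint_privatePoints (by simp)) ?_
    by_cases h : two (l, false)
    · rw [card_privatePoints_of_two (by simpa using h),
        card_privatePoints_of_not_two (by simpa using fun h' => hi l ⟨h, h'⟩)]
    · rw [card_privatePoints_of_not_two (by simpa using h)]
      have : (privatePoints e pt two (e.symm (l, true))).card ≤ 2 := by
        by_cases h' : two (l, true)
        · rw [card_privatePoints_of_two (by simpa using h')]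
        · rw [card_privatePoints_of_not_two (by simpa using h')]; omega
      omega

end PrivatePoints

/-! ### Models with one shared point, degree less than 2 -/

section SharedPoint

open Classical in
/-- Each attribute gets one point, private except that `D` gets the point of `C`. -/
noncomputable def sharedPoint (pt : {A // A ∈ R} ↪ F) (C D A : {A // A ∈ R}) : Finset F :=
  {pt (if A = D then C else A)}

variable {e : {A // A ∈ R} ≃ ZMod n × Bool} {pt : {A // A ∈ R} ↪ F} {C D : {A // A ∈ R}}

theorem disjoint_sharedPoint {A B : {A // A ∈ R}} (h : A ≠ B) (h1 : ¬ (A = C ∧ B = D))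
    (h2 : ¬ (A = D ∧ B = C)) : Disjoint (sharedPoint pt C D A) (sharedPoint pt C D B) := by
  simp only [sharedPoint, Finset.disjoint_singleton, ne_eq, EmbeddingLike.apply_eq_iff_eq]
  split_ifs <;> grind

variable [Field F] [Finite F] [∀ A, Infinite (Dom A)]

theorem sharedPoint_satisfies_key {X : Set {A // A ∈ R}} {A B : {A // A ∈ R}} (hA : A ∈ X)
    (hB : B ∈ X) (h : A ≠ B) (h1 : ¬ (A = C ∧ B = D)) (h2 : ¬ (A = D ∧ B = C)) :
    Satisfies (evalRelation Dom 2 (sharedPoint pt C D)) (.key X) := by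
  classical
  refine evalRelation_satisfies_key (sharedPoint pt C D A ∪ sharedPoint pt C D B) ?_ ?_
  · rw [Finset.card_union_of_disjoint (disjoint_sharedPoint h h1 h2)]
    simp [sharedPoint]
  · intro x hx
    rcases Finset.mem_union.1 hx with hx | hx
    exacts [⟨_, hA, hx⟩, ⟨_, hB, hx⟩]

theorem sharedPoint_satisfies_cycleConstraints {i : ZMod n}
    (hi : ∀ l b, ¬ (C = e.symm (l, b) ∧ D = e.symm (l, !b)))
    (hk : ∀ l ≠ i, ¬ (C = e.symm (l, true) ∧ D = e.symm (l + 1, false)))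
    (hk' : ∀ l ≠ i, ¬ (D = e.symm (l, true) ∧ C = e.symm (l + 1, false))) :
    ∀ ψ ∈ cycleConstraints e i, Satisfies (evalRelation Dom 2 (sharedPoint pt C D)) ψ := by
  refine satisfies_cycleConstraints ?_ ?_ ?_
  · intro X x hx y hy z hz hxy hxz hyz
    by_cases h : (x = C ∧ y = D) ∨ (x = D ∧ y = C)
    · refine sharedPoint_satisfies_key hx hz hxz ?_ ?_ <;> grind
    · exact sharedPoint_satisfies_key hx hy hxy (fun h' => h (.inl h')) (fun h' => h (.inr h'))
  · intro X l hl h1 h2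
    refine sharedPoint_satisfies_key h1 h2 (by simp) ?_ ?_
    · exact fun h => hk l hl ⟨h.1.symm, h.2.symm⟩
    · exact fun h => hk' l hl ⟨h.1.symm, h.2.symm⟩
  · intro l
    refine evalRelation_satisfies_indep (disjoint_sharedPoint (by simp) ?_ ?_)
      (by simp [sharedPoint])
    · exact fun h => hi l false ⟨h.1.symm, h.2.symm⟩
    · exact fun h => hi l true ⟨h.2.symm, h.1.symm⟩

end SharedPoint

theorem zmod_one_ne_zero {n : ℕ} (hn : n ≠ 1) : (1 : ZMod n) ≠ 0 := by
  intro h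
  have := ZMod.val_one'' hn
  rw [h, ZMod.val_zero] at this
  omega

theorem val_sub_add_one {n : ℕ} [NeZero n] (hn : n ≠ 1) {i l : ZMod n} (h : l ≠ i) :
    (l - i).val = (l - (i + 1)).val + 1 := by
  have h0 : 0 < (l - i).val := by
    rw [Nat.pos_iff_ne_zero, Ne, ZMod.val_eq_zero, sub_eq_zero]; exact h
  have h1 : (1 : ZMod n).val = 1 := ZMod.val_one'' hn
  rw [← sub_sub, ZMod.val_sub (h1.trans_le h0), h1, Nat.sub_add_cancel h0]

theorem exists_prime_nonempty_embedding (α : Type*) [Finite α] :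
    ∃ q : ℕ, q.Prime ∧ Nonempty (α ↪ ZMod q) := by
  obtain ⟨q, hq, hp⟩ := Nat.exists_infinite_primes (Nat.card α)
  have : NeZero q := ⟨hp.ne_zero⟩
  have := Fintype.ofFinite α
  refine ⟨q, hp, Function.Embedding.nonempty_of_card_le ?_⟩
  rwa [ZMod.card, ← Nat.card_eq_fintype_card]

/-! ### Refuting constraints outside the closure -/

section Separation

/-- A finite relation over `R` satisfying `cycleConstraints e i` but not `φ` exists. -/
def Separable (Dom : Attr → Type v) (e : {A // A ∈ R} ≃ ZMod n × Bool) (i : ZMod n)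
    (φ : Constraint R) : Prop :=
  ∃ r : Set (Tuple Dom R), r.Finite ∧ (∀ ψ ∈ cycleConstraints e i, Satisfies r ψ) ∧
    ¬ Satisfies r φ

variable [NeZero n] {e : {A // A ∈ R} ≃ ZMod n × Bool} {i : ZMod n} [∀ A, Infinite (Dom A)]

theorem separable_key_of_subset (hn : n ≠ 1) {X : Set {A // A ∈ R}} {j : ZMod n}
    (hX : ∀ A ∈ X, (e A).1 = j) : Separable Dom e i (.key X) := by
  classical
  obtain ⟨q, hq, ⟨pt⟩⟩ := exists_prime_nonempty_embedding ((ZMod n × Bool) × Bool)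
  have : Fact q.Prime := ⟨hq⟩
  -- Positions are counted from `i + 1`, so `p (l + 1) = p l + 1` unless `l = i`: the wrap-around
  -- sits at the omitted key. Second points go to `B` before `j` and to `A` after `j`, leaving two
  -- points in all for the pair `j`, fewer than `d = 3`.
  let p : ZMod n → ℕ := fun l => (l - (i + 1)).val
  let two : ZMod n × Bool → Prop := fun c => if c.2 then p c.1 < p j else p j < p c.1
  refine ⟨evalRelation Dom 3 (privatePoints e pt two), evalRelation_finite,
    privatePoints_satisfies_cycleConstraints ?_ ?_, ?_⟩
  · intro l
    simp only [two]
    simp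
    omega
  · intro l hl
    have := val_sub_add_one hn hl
    simp only [two, p]
    simp
    omega
  · refine evalRelation_not_satisfies_key {pt ((j, false), false), pt ((j, true), false)} ?_ ?_
      (B := e.symm (j + 1, false)) (mem_privatePoints.2 (.inl rfl)) ?_
    · exact lt_of_le_of_lt Finset.card_le_two (by norm_num)
    · intro A hA x hx
      have hj := hX A hA
      rw [mem_privatePoints] at hx
      have ht : ¬ two (e A) := by
        simp only [two, hj]
        simp
      rcases hx with rfl | h
      · rcases h : e A with ⟨a, _ | _⟩ <;> rw [h] at hj <;> simp_all
      · exact absurd h.1 ht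
    · simp [zmod_one_ne_zero hn]

theorem separable_indep_of_mem (hn : n ≠ 1) {X Y : Set {A // A ∈ R}} {j : ZMod n} (hj : j ≠ i)
    (hX : e.symm (j, true) ∈ X) (hY : e.symm (j + 1, false) ∈ Y) :
    Separable Dom e i (.indep X Y) := by
  classical
  obtain ⟨q, hq, ⟨pt⟩⟩ := exists_prime_nonempty_embedding ((ZMod n × Bool) × Bool)
  have : Fact q.Prime := ⟨hq⟩
  let p : ZMod n → ℕ := fun l => (l - (i + 1)).val
  -- The switch from `B` to `A` now falls between `j` and `j + 1`. Both attributes in question get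
  -- two points, and 4 > 3 rules out independence. A shared point would not do here, as it destroys
  -- the required key.
  let two : ZMod n × Bool → Prop := fun c => if c.2 then p c.1 ≤ p j else p j < p c.1
  have hA : two (e (e.symm (j, true))) := by simp [two]
  have hB : two (e (e.symm (j + 1, false))) := by
    have := val_sub_add_one hn hj
    simp only [two, p]
    simp
    omega
  refine ⟨evalRelation Dom 3 (privatePoints e pt two), evalRelation_finite,
    privatePoints_satisfies_cycleConstraints ?_ ?_,
    evalRelation_not_satisfies_indep_of_card hX hY (disjoint_privatePoints (by simp)) ?_
    ⟨_, mem_privatePoints.2 (.inl rfl)⟩ ?_⟩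
  · intro l
    simp only [two]
    simp
  · intro l hl
    have := val_sub_add_one hn hl
    simp only [two, p]
    simp
    omega
  · rw [card_privatePoints_of_two hB]; norm_num
  · rw [card_privatePoints_of_two hB, card_privatePoints_of_two hA]; norm_num

theorem separable_key (hn : n ≠ 1) {X : Set {A // A ∈ R}} (h : ∀ i, .key X ∉ cycleConstraints e i) :
    Separable Dom e i (.key X) := by
  classical
  have h3 : ∀ x ∈ X, ∀ y ∈ X, ∀ z ∈ X, x ≠ y → x ≠ z → y = z := by
    intro x hx y hy z hz hxy hxz
    by_contra hyz
    exact h i (Or.inl ⟨x, hx, y, hy, z, hz, hxy, hxz, hyz⟩)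
  have h2 : ∀ l, ¬ (e.symm (l, true) ∈ X ∧ e.symm (l + 1, false) ∈ X) := by
    intro l hl
    -- Any index other than `l` keeps the key with index `l`.
    exact h (l + 1) (Or.inr ⟨l, fun h => zmod_one_ne_zero hn (left_eq_add.1 h), hl⟩)
  by_cases hX : ∃ j, ∀ A ∈ X, (e A).1 = j
  · obtain ⟨j, hX⟩ := hX
    exact separable_key_of_subset hn hX
  push Not at hX
  obtain ⟨C, hC, -⟩ := hX 0
  obtain ⟨D, hD, hCD⟩ := hX (e C).1
  have hne : C ≠ D := by rintro rfl; exact hCD rfl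
  obtain ⟨q, hq, ⟨pt⟩⟩ := exists_prime_nonempty_embedding {A // A ∈ R}
  have : Fact q.Prime := ⟨hq⟩
  refine ⟨evalRelation Dom 2 (sharedPoint pt C D), evalRelation_finite,
    sharedPoint_satisfies_cycleConstraints ?_ ?_ ?_, ?_⟩
  · rintro l b ⟨rfl, rfl⟩
    simp at hCD
  · rintro l - ⟨rfl, rfl⟩
    exact h2 l ⟨hC, hD⟩
  · rintro l - ⟨rfl, rfl⟩
    exact h2 l ⟨hD, hC⟩
  · have hED : e.symm ((e C).1, !(e C).2) ≠ D := by
      rintro rfl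
      simp at hCD
    have hEC : e.symm ((e C).1, !(e C).2) ≠ C := by
      rw [Ne, Equiv.symm_apply_eq]
      intro h
      simpa using congrArg Prod.snd h
    refine evalRelation_not_satisfies_key {pt C} (by simp) ?_
      (B := e.symm ((e C).1, !(e C).2)) (y := pt (e.symm ((e C).1, !(e C).2))) ?_ ?_
    · intro A hA
      have : A = C ∨ A = D := by
        by_contra! hA'
        exact hA'.2 (h3 C hC A hA D hD hA'.1.symm hne)
      rcases this with rfl | rfl <;> simp [sharedPoint]
    · simp [sharedPoint, hED]
    · simpa using hEC

theorem separable_indep (hn : n ≠ 1) {X Y : Set {A // A ∈ R}} (h : .indep X Y ∉ cycleConstraints e i) :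
    Separable Dom e i (.indep X Y) := by
  have hX : X.Nonempty := Set.nonempty_iff_ne_empty.2 fun h' => h (Or.inl h')
  have hY : Y.Nonempty := Set.nonempty_iff_ne_empty.2 fun h' => h (Or.inr (Or.inl h'))
  -- If all of `X` were partnered with all of `Y`, both would be singletons forming a pair of the
  -- cycle. Here `C = D` is possible.
  obtain ⟨C, hC, D, hD, hCD⟩ : ∃ C ∈ X, ∃ D ∈ Y, e D ≠ ((e C).1, !(e C).2) := by
    by_contra! hall
    obtain ⟨C, hC⟩ := hX
    obtain ⟨D, hD⟩ := hY
    refine h (Or.inr (Or.inr ⟨(e C).1, (e C).2, ?_, ?_⟩))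
    · refine Set.eq_singleton_iff_unique_mem.2 ⟨by simpa using hC, fun A hA => ?_⟩
      rw [Prod.mk.eta, Equiv.symm_apply_apply]
      have h1 := (hall A hA D hD).symm.trans (hall C hC D hD)
      simp only [Prod.mk.injEq, Bool.not_inj_iff] at h1
      exact e.injective (Prod.ext h1.1 h1.2)
    · rw [← hall C hC D hD, Equiv.symm_apply_apply]
      exact Set.eq_singleton_iff_unique_mem.2
        ⟨hD, fun A hA => e.injective ((hall C hC A hA).trans (hall C hC D hD).symm)⟩
  by_cases h1 : ∃ j ≠ i, C = e.symm (j, true) ∧ D = e.symm (j + 1, false)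
  · obtain ⟨j, hj, rfl, rfl⟩ := h1
    exact separable_indep_of_mem hn hj hC hD
  by_cases h2 : ∃ j ≠ i, D = e.symm (j, true) ∧ C = e.symm (j + 1, false)
  · obtain ⟨j, hj, rfl, rfl⟩ := h2
    obtain ⟨r, hr, hsat, hns⟩ := separable_indep_of_mem (Dom := Dom) hn hj hD hC
    exact ⟨r, hr, hsat, fun h => hns h.indep_symm⟩
  obtain ⟨q, hq, ⟨pt⟩⟩ := exists_prime_nonempty_embedding {A // A ∈ R}
  have : Fact q.Prime := ⟨hq⟩
  refine ⟨evalRelation Dom 2 (sharedPoint pt C D), evalRelation_finite,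
    sharedPoint_satisfies_cycleConstraints ?_ (fun l hl h => h1 ⟨l, hl, h⟩)
      (fun l hl h => h2 ⟨l, hl, h⟩),
    evalRelation_not_satisfies_indep_of_mem hC hD two_pos (x := pt C) ?_ ?_⟩
  · rintro l b ⟨rfl, rfl⟩
    simp at hCD
  · simp [sharedPoint]
  · simp [sharedPoint]

theorem separable_of_forall_notMem (hn : n ≠ 1) {φ : Constraint R} (h : ∀ i, φ ∉ cycleConstraints e i) :
    Separable Dom e i φ := by
  cases φ with
  | key X => exact separable_key hn h
  | indep X Y => exact separable_indep hn (h i)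

end Separation

/-- With more than `k` indices, the union of the sets `cycleConstraints e i` is closed under
sound rules with at most `k` premises. -/
theorem exists_mem_cycleConstraints_of_derives [NeZero n] [∀ A, Infinite (Dom A)] {k : ℕ}
    (hn : n ≠ 1) (hk : k < n) (e : {A // A ∈ R} ≃ ZMod n × Bool) {I : Set (InferenceRule Attr)}
    (hI : IsAry k I) (hs : FinSound Dom I) {φ : Constraint R}
    (h : Derives I {ψ | ∃ i, ψ ∈ cycleConstraints e i} φ) : ∃ i, φ ∈ cycleConstraints e i := by
  classical
  induction h with
  | hyp h => exact h
  | @step ρ hρ P φ hinst _ ih =>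
    choose j hj using fun m => (ih m).elim fun _ => exists_forall_ne_mem_cycleConstraints
    obtain ⟨i, hi⟩ : ∃ i, i ∉ Finset.univ.image j := by
      by_contra! hall
      have h1 : Finset.univ.image j = Finset.univ := Finset.eq_univ_of_forall hall
      have h2 : (Finset.univ.image j).card ≤ ρ.arity := Finset.card_image_le.trans (by simp)
      rw [h1, Finset.card_univ, ZMod.card] at h2
      have := hI ρ hρ
      omega
    by_contra! hφ
    obtain ⟨r, hr, hsat, hns⟩ := separable_of_forall_notMem (Dom := Dom) (i := i) hn hφ
    -- Soundness is applied to this single rule instance, with only its premises as hypotheses.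
    refine hns (hs R (Set.range P) φ (.step hρ hinst fun m => .hyp ⟨m, rfl⟩) r hr ?_)
    rintro _ ⟨m, rfl⟩
    refine hsat _ (hj m i ?_)
    rintro rfl
    exact hi (Finset.mem_image_of_mem _ (Finset.mem_univ _))

theorem finImplies_key_of_cycleConstraints [NeZero n] (hn : n ≠ 1)
    (e : {A // A ∈ R} ≃ ZMod n × Bool) (l : ZMod n) :
    FinImplies Dom {ψ | ∃ i, ψ ∈ cycleConstraints e i}
      (.key {e.symm (l, false), e.symm (l, true)}) := by
  intro r hr h
  refine key_of_cycle (fun l => e.symm (l, false)) (fun l => e.symm (l, true)) hr ?_ ?_ l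
  · exact fun l => h _ ⟨0, Or.inr (Or.inr ⟨l, false, rfl, rfl⟩)⟩
  · exact fun l => h _ ⟨l + 1, Or.inr
      ⟨l, fun h => zmod_one_ne_zero hn (left_eq_add.1 h), by simp, by simp⟩⟩

theorem key_notMem_cycleConstraints [NeZero n] (hn : n ≠ 1)
    (e : {A // A ∈ R} ≃ ZMod n × Bool) (l i : ZMod n) :
    .key {e.symm (l, false), e.symm (l, true)} ∉ cycleConstraints e i := by
  rintro (⟨x, rfl | rfl, y, rfl | rfl, z, rfl | rfl, hxy, hxz, hyz⟩ | ⟨j, -, h1, h2⟩)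
  all_goals try contradiction
  simp only [Set.mem_insert_iff, Set.mem_singleton_iff, EmbeddingLike.apply_eq_iff_eq,
    Prod.mk.injEq, Bool.true_eq_false, Bool.false_eq_true, and_false, and_true, or_false,
    false_or] at h1 h2
  rw [h1] at h2
  exact zmod_one_ne_zero hn (add_eq_left.1 h2)

end Cycle

end KeyIndep

theorem mainTheorem7 {Attr : Type*} [Infinite Attr] (Dom : Attr → Type*)
    [∀ A, Infinite (Dom A)] (k : ℕ) :
    ¬ ∃ I : Set (KeyIndep.InferenceRule Attr),
      KeyIndep.IsAry k I ∧ KeyIndep.FinSound Dom I ∧ KeyIndep.FinComplete Dom I := by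
  rintro ⟨I, hI, hs, hc⟩
  -- The cycle length `k + 2` exceeds `k` and is never 1; with length 1 the key `k(B l, A (l + 1))`
  -- would already be the conclusion.
  obtain ⟨R, hR⟩ := Infinite.exists_subset_card_eq Attr ((k + 2) * 2)
  have e : {A // A ∈ R} ≃ ZMod (k + 2) × Bool :=
    Fintype.equivOfCardEq (by simp [hR, ZMod.card])
  have hn : k + 2 ≠ 1 := by omega
  obtain ⟨i, hi⟩ := KeyIndep.exists_mem_cycleConstraints_of_derives hn (by omega) e hI hs
    (hc R _ _ (KeyIndep.finImplies_key_of_cycleConstraints hn e 0))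
  exact KeyIndep.key_notMem_cycleConstraints hn e 0 i hi
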